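/- Let ZFG[$0$] be the first-order theory, in the language with equality, membership $\in$ and a binary relation $\leq_\gamma$, whose axioms are those of Zermelo–Fraenkel set theory without power set (extensionality, foundation, pairing, union, infinity, and the separation and replacement schemes for all formulas of this language, with parameters, including those that mention $\leq_\gamma$), together with the axioms saying that $\leq_\gamma$ is a linear order of all sets such that every non-empty class, defined by any formula of this language with parameters, has a $\leq_\gamma$-least element. Then it is a theorem of ZFG[$0$] (a consequence of its axioms in first-order logic) that every Noetherian ring $R$ has a set $\mathrm{Id}(R)$ whose members are exactly the ideals of $R$, and a set $\mathrm{Spec}(R)$ whose members are exactly the prime ideals of $R$. Here rings are commutative with unit, and $R$ is Noetherian if every ideal of $R$ is generated by a finite subset of $R$. -/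

import Mathlib

open FirstOrder

namespace ZFG

/-! ## The first-order language of set theory with a global order -/

/-- The two binary relation symbols: membership, and the global order of all sets. -/
inductive Rel : ℕ → Type
  | mem : Rel 2
  | le : Rel 2

/-- The first-order language with the relation symbols for membership and for the global order,
besides equality. -/
def lang : Language := ⟨fun _ => Empty, Rel⟩

/-- Formulas of set theory whose free variables are numbered by `Fin n`. -/
abbrev Fml (n : ℕ) : Type := lang.BoundedFormula Empty n

/-- The atomic formula saying that `x` is a member of `y`. -/
def mem {n : ℕ} (x y : Fin n) : Fml n :=
  Language.Relations.boundedFormula₂ (L := lang) Rel.mem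
    (Language.Term.var (Sum.inr x)) (Language.Term.var (Sum.inr y))

/-- The atomic formula saying that `x` precedes or equals `y` in the global order. -/
def le {n : ℕ} (x y : Fin n) : Fml n :=
  Language.Relations.boundedFormula₂ (L := lang) Rel.le
    (Language.Term.var (Sum.inr x)) (Language.Term.var (Sum.inr y))

/-- The atomic formula saying that `x` equals `y`. -/
def eq {n : ℕ} (x y : Fin n) : Fml n :=
  Language.Term.bdEqual (L := lang)
    (Language.Term.var (Sum.inr x)) (Language.Term.var (Sum.inr y))

infix:88 " ∈ᶠ " => ZFG.mem
infix:88 " ≤ᶠ " => ZFG.le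
infix:88 " ≐ᶠ " => ZFG.eq

/-- Universal quantification over the last `k` variables. -/
def closeAll {n : ℕ} : (k : ℕ) → Fml (n + k) → Fml n
  | 0, φ => φ
  | k + 1, φ => closeAll k (Language.BoundedFormula.all φ)

/-- Existential quantification over the last `k` variables. -/
def closeEx {n : ℕ} : (k : ℕ) → Fml (n + k) → Fml n
  | 0, φ => φ
  | k + 1, φ => closeEx k (Language.BoundedFormula.ex φ)

/-- `all k fun w v => φ` is the formula "for all sets `v 0, …, v (k - 1)`, `φ`"; inside `φ` an old
variable `x` is written `w x`. -/
def all {n : ℕ} (k : ℕ) (φ : (Fin n → Fin (n + k)) → (Fin k → Fin (n + k)) → Fml (n + k)) :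
    Fml n :=
  closeAll k (φ (Fin.castAdd k) (Fin.natAdd n))

/-- `ex k fun w v => φ` is the formula "there are sets `v 0, …, v (k - 1)` with `φ`"; inside `φ` an
old variable `x` is written `w x`. -/
def ex {n : ℕ} (k : ℕ) (φ : (Fin n → Fin (n + k)) → (Fin k → Fin (n + k)) → Fml (n + k)) :
    Fml n :=
  closeEx k (φ (Fin.castAdd k) (Fin.natAdd n))

/-! ## Basic set-theoretic formulas -/

/-- `x ⊆ y`. -/
def subset {n : ℕ} (x y : Fin n) : Fml n :=
  all 1 fun w v => v 0 ∈ᶠ w x ⟹ v 0 ∈ᶠ w y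

/-- `x = ∅`. -/
def isEmpty {n : ℕ} (x : Fin n) : Fml n :=
  all 1 fun w v => ∼(v 0 ∈ᶠ w x)

/-- `z = {a, b}`. -/
def isUnorderedPair {n : ℕ} (z a b : Fin n) : Fml n :=
  all 1 fun w v => v 0 ∈ᶠ w z ⇔ (v 0 ≐ᶠ w a ⊔ v 0 ≐ᶠ w b)

/-- `p = (a, b) = {{a}, {a, b}}`. -/
def isPair {n : ℕ} (p a b : Fin n) : Fml n :=
  all 1 fun w v => v 0 ∈ᶠ w p ⇔
    (isUnorderedPair (v 0) (w a) (w a) ⊔ isUnorderedPair (v 0) (w a) (w b))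

/-- `y = x ∪ {x}`. -/
def isSucc {n : ℕ} (y x : Fin n) : Fml n :=
  all 1 fun w v => v 0 ∈ᶠ w y ⇔ (v 0 ∈ᶠ w x ⊔ v 0 ≐ᶠ w x)

/-- `W` contains `∅`, and contains `x ∪ {x}` whenever it contains `x`. -/
def isInductive {n : ℕ} (W : Fin n) : Fml n :=
  (ex 1 fun w v => isEmpty (v 0) ⊓ v 0 ∈ᶠ w W) ⊓
  (all 1 fun w v => v 0 ∈ᶠ w W ⟹
    ex 1 fun w' y => isSucc (y 0) (w' (v 0)) ⊓ y 0 ∈ᶠ w' (w W))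

/-- `m` is a natural number (finite von Neumann ordinal): it lies in every inductive set. -/
def isNat {n : ℕ} (m : Fin n) : Fml n :=
  all 1 fun w v => isInductive (v 0) ⟹ w m ∈ᶠ v 0

/-- `(a, b) ∈ f`. -/
def pairMem {n : ℕ} (f a b : Fin n) : Fml n :=
  ex 1 fun w v => isPair (v 0) (w a) (w b) ⊓ v 0 ∈ᶠ w f

/-- `f` is (the graph of) a bijection from the set `A` to the set `B`. -/
def isBijection {n : ℕ} (f A B : Fin n) : Fml n :=
  (all 1 fun w q => q 0 ∈ᶠ w f ⟹
    ex 2 fun w' v => v 0 ∈ᶠ w' (w A) ⊓ v 1 ∈ᶠ w' (w B) ⊓ isPair (w' (q 0)) (v 0) (v 1)) ⊓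
  (all 1 fun w a => a 0 ∈ᶠ w A ⟹
    ex 1 fun w' b => b 0 ∈ᶠ w' (w B) ⊓
      all 1 fun w'' c => pairMem (w'' (w' (w f))) (w'' (w' (a 0))) (c 0) ⇔ c 0 ≐ᶠ w'' (b 0)) ⊓
  (all 1 fun w b => b 0 ∈ᶠ w B ⟹
    ex 1 fun w' a => a 0 ∈ᶠ w' (w A) ⊓
      all 1 fun w'' c => pairMem (w'' (w' (w f))) (c 0) (w'' (w' (b 0))) ⇔ c 0 ≐ᶠ w'' (a 0))

/-- `S` is finite: it is in bijection with a natural number. -/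
def isFinite {n : ℕ} (S : Fin n) : Fml n :=
  ex 2 fun w v => isNat (v 0) ⊓ isBijection (v 1) (v 0) (w S)

/-! ## The axioms -/

/-- A formula `φ` with parameters indexed by `Fin n` and `k` further variables, placed in a context
of `m` variables: the parameters become the variables `ps 0, …, ps (n - 1)`, and the further
variables become `xs 0, …, xs (k - 1)`. -/
def place {n k m : ℕ} (φ : lang.Formula (Fin n ⊕ Fin k)) (ps : Fin n → Fin m)
    (xs : Fin k → Fin m) : Fml m :=
  Language.BoundedFormula.relabel (k := 0)
    (Sum.elim (fun i => Sum.inr (ps i)) (fun j => Sum.inr (xs j))) φ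

/-- Sets with the same members are equal. -/
def extensionality : lang.Sentence :=
  all 2 fun _ v => (all 1 fun w z => z 0 ∈ᶠ w (v 0) ⇔ z 0 ∈ᶠ w (v 1)) ⟹ v 0 ≐ᶠ v 1

/-- Every non-empty set has a member that is disjoint from it. -/
def foundation : lang.Sentence :=
  all 1 fun _ x => (ex 1 fun w y => y 0 ∈ᶠ w (x 0)) ⟹
    ex 1 fun w y => y 0 ∈ᶠ w (x 0) ⊓
      all 1 fun w' z => z 0 ∈ᶠ w' (y 0) ⟹ ∼(z 0 ∈ᶠ w' (w (x 0)))

/-- Any two sets have an unordered pair. -/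
def pairing : lang.Sentence :=
  all 2 fun _ v => ex 1 fun w z => isUnorderedPair (z 0) (w (v 0)) (w (v 1))

/-- Every set of sets has a union. -/
def union : lang.Sentence :=
  all 1 fun _ x => ex 1 fun w u => all 1 fun w' z =>
    z 0 ∈ᶠ w' (u 0) ⇔ ex 1 fun w'' y => y 0 ∈ᶠ w'' (w' (w (x 0))) ⊓ w'' (z 0) ∈ᶠ y 0

/-- There is an inductive set. -/
def infinity : lang.Sentence :=
  ex 1 fun _ W => isInductive (W 0)

/-- Separation for the formula `φ(p, x)`: for all parameters `p` and every set `A` there is a set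
`B` whose members are the members `x` of `A` with `φ(p, x)`. -/
def separation {n : ℕ} (φ : lang.Formula (Fin n ⊕ Fin 1)) : lang.Sentence :=
  Language.BoundedFormula.alls (n := n) <|
    all 1 fun w A => ex 1 fun w₁ B => all 1 fun w₂ x =>
      x 0 ∈ᶠ w₂ (B 0) ⇔
        (x 0 ∈ᶠ w₂ (w₁ (A 0)) ⊓ place φ (fun i => w₂ (w₁ (w i))) ![x 0])

/-- Replacement for the formula `φ(p, x, y)`: for all parameters `p` and every set `A`, if for each
`x` in `A` there is at most one `y` with `φ(p, x, y)`, then there is a set `B` whose members are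
the `y` with `φ(p, x, y)` for some `x` in `A`. -/
def replacement {n : ℕ} (φ : lang.Formula (Fin n ⊕ Fin 2)) : lang.Sentence :=
  Language.BoundedFormula.alls (n := n) <|
    all 1 fun w A =>
      (all 3 fun w₁ v =>
        (v 0 ∈ᶠ w₁ (A 0) ⊓ place φ (fun i => w₁ (w i)) ![v 0, v 1] ⊓
          place φ (fun i => w₁ (w i)) ![v 0, v 2]) ⟹ v 1 ≐ᶠ v 2) ⟹
      ex 1 fun w₁ B => all 1 fun w₂ y =>
        y 0 ∈ᶠ w₂ (B 0) ⇔
          ex 1 fun w₃ x => x 0 ∈ᶠ w₃ (w₂ (w₁ (A 0))) ⊓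
            place φ (fun i => w₃ (w₂ (w₁ (w i)))) ![x 0, w₃ (y 0)]

/-- The global order is a linear order of all sets. -/
def linearOrder : lang.Sentence :=
  (all 1 fun _ v => v 0 ≤ᶠ v 0) ⊓
  (all 2 fun _ v => (v 0 ≤ᶠ v 1 ⊓ v 1 ≤ᶠ v 0) ⟹ v 0 ≐ᶠ v 1) ⊓
  (all 3 fun _ v => (v 0 ≤ᶠ v 1 ⊓ v 1 ≤ᶠ v 2) ⟹ v 0 ≤ᶠ v 2) ⊓
  (all 2 fun _ v => v 0 ≤ᶠ v 1 ⊔ v 1 ≤ᶠ v 0)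

/-- Least elements for the class of all `y` with `φ(p, y)`: for all parameters `p`, if the class is
non-empty, then it has a least element in the global order. -/
def leastElement {n : ℕ} (φ : lang.Formula (Fin n ⊕ Fin 1)) : lang.Sentence :=
  Language.BoundedFormula.alls (n := n) <|
    (ex 1 fun w y => place φ w ![y 0]) ⟹
      ex 1 fun w y => place φ w ![y 0] ⊓
        all 1 fun w' z => place φ (fun i => w' (w i)) ![z 0] ⟹ w' (y 0) ≤ᶠ z 0

/-- The theory ZFG[0]: Zermelo-Fraenkel set theory without the power set axiom, with a global
well-ordering, where the axiom schemes range over all formulas in membership and the order. -/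
inductive ZFG0 : lang.Theory
  | extensionality : ZFG0 extensionality
  | foundation : ZFG0 foundation
  | pairing : ZFG0 pairing
  | union : ZFG0 union
  | infinity : ZFG0 infinity
  | separation {n : ℕ} (φ : lang.Formula (Fin n ⊕ Fin 1)) : ZFG0 (separation φ)
  | replacement {n : ℕ} (φ : lang.Formula (Fin n ⊕ Fin 2)) : ZFG0 (replacement φ)
  | linearOrder : ZFG0 linearOrder
  | leastElement {n : ℕ} (φ : lang.Formula (Fin n ⊕ Fin 1)) : ZFG0 (leastElement φ)

/-! ## Rings and ideals inside set theory -/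

/-- Five variables standing for the data of a ring: underlying set, addition, multiplication, zero
and one. -/
structure RingVars (n : ℕ) where
  carrier : Fin n
  add : Fin n
  mul : Fin n
  zero : Fin n
  one : Fin n

/-- Renaming of variables. -/
def RingVars.map {n m : ℕ} (X : RingVars n) (w : Fin n → Fin m) : RingVars m :=
  ⟨w X.carrier, w X.add, w X.mul, w X.zero, w X.one⟩

/-- `((a, b), c) ∈ f`, that is, `f(a, b) = c`. -/
def opEq {n : ℕ} (f a b c : Fin n) : Fml n :=
  ex 1 fun w p => isPair (p 0) (w a) (w b) ⊓ pairMem (w f) (p 0) (w c)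

/-- `f` is (the graph of) a function from `A × A` to `A`. -/
def isBinaryOp {n : ℕ} (f A : Fin n) : Fml n :=
  (all 1 fun w q => q 0 ∈ᶠ w f ⟹
    ex 4 fun w' v => v 0 ∈ᶠ w' (w A) ⊓ v 1 ∈ᶠ w' (w A) ⊓ v 2 ∈ᶠ w' (w A) ⊓
      isPair (v 3) (v 0) (v 1) ⊓ isPair (w' (q 0)) (v 3) (v 2)) ⊓
  (all 2 fun w v => (v 0 ∈ᶠ w A ⊓ v 1 ∈ᶠ w A) ⟹
    ex 1 fun w' c => c 0 ∈ᶠ w' (w A) ⊓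
      all 1 fun w'' d =>
        opEq (w'' (w' (w f))) (w'' (w' (v 0))) (w'' (w' (v 1))) (d 0) ⇔ d 0 ≐ᶠ w'' (c 0))

/-- `f(a, b) = f(b, a)`. -/
def isCommutative {n : ℕ} (f : Fin n) : Fml n :=
  all 3 fun w v => opEq (w f) (v 0) (v 1) (v 2) ⟹ opEq (w f) (v 1) (v 0) (v 2)

/-- `f(f(a, b), c) = f(a, f(b, c))`, where `a, b, c` are `v 0, v 1, v 2`. -/
def isAssociative {n : ℕ} (f : Fin n) : Fml n :=
  all 6 fun w v =>
    (opEq (w f) (v 0) (v 1) (v 3) ⊓ opEq (w f) (v 3) (v 2) (v 4) ⊓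
      opEq (w f) (v 1) (v 2) (v 5)) ⟹ opEq (w f) (v 0) (v 5) (v 4)

/-- `e ∈ A`, and `f(a, e) = a` for all `a ∈ A`. -/
def isNeutral {n : ℕ} (f A e : Fin n) : Fml n :=
  e ∈ᶠ A ⊓ all 1 fun w a => a 0 ∈ᶠ w A ⟹ opEq (w f) (a 0) (w e) (a 0)

/-- `a * (b + c) = a * b + a * c`, where `a, b, c` are `v 0, v 1, v 2`. -/
def isDistributive {n : ℕ} (add mul : Fin n) : Fml n :=
  all 7 fun w v =>
    (opEq (w add) (v 1) (v 2) (v 3) ⊓ opEq (w mul) (v 0) (v 3) (v 4) ⊓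
      opEq (w mul) (v 0) (v 1) (v 5) ⊓ opEq (w mul) (v 0) (v 2) (v 6)) ⟹
        opEq (w add) (v 5) (v 6) (v 4)

/-- `X` is a commutative ring with unit. -/
def isRing {n : ℕ} (X : RingVars n) : Fml n :=
  isBinaryOp X.add X.carrier ⊓ isBinaryOp X.mul X.carrier ⊓
  isCommutative X.add ⊓ isAssociative X.add ⊓ isNeutral X.add X.carrier X.zero ⊓
  (all 1 fun w a => a 0 ∈ᶠ w X.carrier ⟹
    ex 1 fun w' b => b 0 ∈ᶠ w' (w X.carrier) ⊓
      opEq (w' (w X.add)) (w' (a 0)) (b 0) (w' (w X.zero))) ⊓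
  isCommutative X.mul ⊓ isAssociative X.mul ⊓ isNeutral X.mul X.carrier X.one ⊓
  isDistributive X.add X.mul

/-- `I` is an ideal of the ring `X`. -/
def isIdeal {n : ℕ} (X : RingVars n) (I : Fin n) : Fml n :=
  subset I X.carrier ⊓ X.zero ∈ᶠ I ⊓
  (all 3 fun w v => (v 0 ∈ᶠ w I ⊓ v 1 ∈ᶠ w I ⊓ opEq (w X.add) (v 0) (v 1) (v 2)) ⟹
    v 2 ∈ᶠ w I) ⊓
  (all 3 fun w v => (v 0 ∈ᶠ w X.carrier ⊓ v 1 ∈ᶠ w I ⊓ opEq (w X.mul) (v 0) (v 1) (v 2)) ⟹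
    v 2 ∈ᶠ w I)

/-- `P` is a prime ideal of the ring `X`. -/
def isPrimeIdeal {n : ℕ} (X : RingVars n) (P : Fin n) : Fml n :=
  isIdeal X P ⊓ ∼(X.one ∈ᶠ P) ⊓
  (all 3 fun w v =>
    (v 0 ∈ᶠ w X.carrier ⊓ v 1 ∈ᶠ w X.carrier ⊓ opEq (w X.mul) (v 0) (v 1) (v 2) ⊓
      v 2 ∈ᶠ w P) ⟹ (v 0 ∈ᶠ w P ⊔ v 1 ∈ᶠ w P))

/-- `I` is the ideal of `X` generated by `S`: the least ideal that includes `S`. -/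
def isGeneratedBy {n : ℕ} (X : RingVars n) (I S : Fin n) : Fml n :=
  isIdeal X I ⊓ subset S I ⊓
  (all 1 fun w J => (isIdeal (X.map w) (J 0) ⊓ subset (w S) (J 0)) ⟹ subset (w I) (J 0))

/-- `X` is a Noetherian ring: a commutative ring with unit in which every ideal is generated by a
finite subset. -/
def isNoetherianRing {n : ℕ} (X : RingVars n) : Fml n :=
  isRing X ⊓
  (all 1 fun w I => isIdeal (X.map w) (I 0) ⟹
    ex 1 fun w' S => subset (S 0) (w' (w X.carrier)) ⊓ isFinite (S 0) ⊓
      isGeneratedBy ((X.map w).map w') (w' (I 0)) (S 0))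

/-- There is a set whose members are exactly the ideals of the ring `X`. -/
def hasSetOfIdeals {n : ℕ} (X : RingVars n) : Fml n :=
  ex 1 fun w Id => all 1 fun w' I => I 0 ∈ᶠ w' (Id 0) ⇔ isIdeal ((X.map w).map w') (I 0)

/-- There is a set whose members are exactly the prime ideals of the ring `X`. -/
def hasSetOfPrimeIdeals {n : ℕ} (X : RingVars n) : Fml n :=
  ex 1 fun w Spec => all 1 fun w' P =>
    P 0 ∈ᶠ w' (Spec 0) ⇔ isPrimeIdeal ((X.map w).map w') (P 0)

/-- The sentence of set theory saying that every Noetherian ring has a set of all ideals and a set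
of all prime ideals. -/
def noetherianRingsHaveIdAndSpec : lang.Sentence :=
  all 5 fun _ v =>
    let X : RingVars (0 + 5) := ⟨v 0, v 1, v 2, v 3, v 4⟩
    isNoetherianRing X ⟹ (hasSetOfIdeals X ⊓ hasSetOfPrimeIdeals X)

end ZFG

namespace ZFG

open Language Matrix

/-! ### Set-theoretic notions read in a structure -/

section Semantics

variable {M : Type*} [lang.Structure M]

/-! Without power set, the ideals of `R` cannot be separated from the set of all subsets. The finite
subsets of `R` do form a set, however. By induction on `m`, the subsets of size `m` form one:
deleting a point shows that each subset of size `m + 1` is `s ∪ {r}` with `s` of size `m` and `r` in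
`R`, and replacement and union collect all such `s ∪ {r}` (`exists_insertions`,
`exists_subsetsOfSize`). A union over ω gives `exists_finiteSubsets`. A set generates at most one
ideal, and in a Noetherian ring every ideal is generated by some finite subset. So replacement along
"`S` generates `I`" yields the set of ideals, and separation yields the set of primes. The argument
runs inside an arbitrary model `M`. Each use of a scheme, induction included, needs an actual
formula; the `realize_*` lemmas identify such formulas with predicates on `M`. -/

/-- Membership in a structure for the language of set theory. -/
def Mem (x y : M) : Prop := Structure.RelMap (L := lang) Rel.mem ![x, y]

local infix:50 " ε " => Mem

/-- `x ⊆ y`. -/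
def Subset (x y : M) : Prop := ∀ z, z ε x → z ε y

/-- `x = ∅`. -/
def IsEmpty (x : M) : Prop := ∀ z, ¬ z ε x

/-- `z = {a, b}`. -/
def IsUnorderedPair (z a b : M) : Prop := ∀ x, x ε z ↔ x = a ∨ x = b

/-- `p = (a, b)`. -/
def IsPair (p a b : M) : Prop := ∀ x, x ε p ↔ IsUnorderedPair x a a ∨ IsUnorderedPair x a b

/-- `t = s ∪ {r}`. -/
def IsInsert (t s r : M) : Prop := ∀ x, x ε t ↔ x ε s ∨ x = r

/-- `W` contains `∅` and is closed under successors. -/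
def IsInductive (W : M) : Prop :=
  (∃ x, IsEmpty x ∧ x ε W) ∧ ∀ x, x ε W → ∃ y, IsInsert y x x ∧ y ε W

/-- `m` is a natural number. -/
def IsNat (m : M) : Prop := ∀ W, IsInductive W → m ε W

/-- `(a, b) ∈ f`. -/
def PairMem (f a b : M) : Prop := ∃ p, IsPair p a b ∧ p ε f

/-- `f` is a bijection from `A` to `B`. -/
def IsBijection (f A B : M) : Prop :=
  ((∀ q, q ε f → ∃ a b, (a ε A ∧ b ε B) ∧ IsPair q a b) ∧
    ∀ a, a ε A → ∃ b, b ε B ∧ ∀ c, PairMem f a c ↔ c = b) ∧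
  ∀ b, b ε B → ∃ a, a ε A ∧ ∀ c, PairMem f c b ↔ c = a

/-- `f(a, b) = c`. -/
def OpEq (f a b c : M) : Prop := ∃ p, IsPair p a b ∧ PairMem f p c

/-- `I` is an ideal of the ring with the given carrier, addition, multiplication and zero. -/
def IsIdeal (R add mul zero I : M) : Prop :=
  ((Subset I R ∧ zero ε I) ∧
    ∀ a b c, (a ε I ∧ b ε I) ∧ OpEq add a b c → c ε I) ∧
  ∀ a b c, (a ε R ∧ b ε I) ∧ OpEq mul a b c → c ε I

/-- `P` is a prime ideal of the ring with the given data. -/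
def IsPrimeIdeal (R add mul zero one P : M) : Prop :=
  (IsIdeal R add mul zero P ∧ ¬ one ε P) ∧
  ∀ a b c, ((a ε R ∧ b ε R) ∧ OpEq mul a b c) ∧ c ε P → a ε P ∨ b ε P

/-- `I` is the least ideal that includes `S`. -/
def IsGeneratedBy (R add mul zero I S : M) : Prop :=
  (IsIdeal R add mul zero I ∧ Subset S I) ∧
  ∀ J, IsIdeal R add mul zero J ∧ Subset S J → Subset I J

/-- `S` is a subset of `R` in bijection with `m`. -/
def IsSubsetOfSize (R m S : M) : Prop := Subset S R ∧ ∃ f, IsBijection f m S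

/-! ### Truth of formulas in a structure -/

section Realize

variable {n : ℕ} {e : Empty → M} {xs : Fin n → M}

@[simp] theorem realize_mem (x y : Fin n) : (mem x y).Realize e xs ↔ xs x ε xs y := by
  exact BoundedFormula.realize_rel₂ (L := lang)

@[simp] theorem realize_eq (x y : Fin n) : (eq x y).Realize e xs ↔ xs x = xs y := by
  simp [eq]

theorem realize_closeAll : ∀ (k : ℕ) (φ : Fml (n + k)),
    (closeAll k φ).Realize e xs ↔ ∀ ys : Fin k → M, φ.Realize e (Fin.append xs ys)
  | 0, φ => by
    simp only [closeAll, Fin.forall_fin_zero_pi]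
    rw [Fin.append_right_nil xs _ rfl]; rfl
  | k + 1, φ => by
    -- The last variable is bound innermost, whereas `Fin.snocEquiv` lists the last entry first;
    -- hence the exchange of quantifiers.
    rw [closeAll, realize_closeAll k, (Fin.snocEquiv fun _ => M).symm.forall_congr_left,
      Prod.forall, forall_comm]
    refine forall_congr' fun ys => forall_congr' fun y => ?_
    rw [← Fin.append_snoc]; rfl

theorem realize_closeEx : ∀ (k : ℕ) (φ : Fml (n + k)),
    (closeEx k φ).Realize e xs ↔ ∃ ys : Fin k → M, φ.Realize e (Fin.append xs ys)
  | 0, φ => by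
    simp only [closeEx, Fin.exists_fin_zero_pi]
    rw [Fin.append_right_nil xs _ rfl]; rfl
  | k + 1, φ => by
    rw [closeEx, realize_closeEx k, (Fin.snocEquiv fun _ => M).symm.exists_congr_left,
      Prod.exists, exists_comm]
    refine exists_congr fun ys => ?_
    rw [BoundedFormula.realize_ex]
    refine exists_congr fun y => ?_
    rw [← Fin.append_snoc]; rfl

@[simp] theorem realize_all {k : ℕ}
    {φ : (Fin n → Fin (n + k)) → (Fin k → Fin (n + k)) → Fml (n + k)} :
    (all k φ).Realize e xs ↔
      ∀ ys : Fin k → M, (φ (Fin.castAdd k) (Fin.natAdd n)).Realize e (Fin.append xs ys) :=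
  realize_closeAll k _

@[simp] theorem realize_ex {k : ℕ}
    {φ : (Fin n → Fin (n + k)) → (Fin k → Fin (n + k)) → Fml (n + k)} :
    (ex k φ).Realize e xs ↔
      ∃ ys : Fin k → M, (φ (Fin.castAdd k) (Fin.natAdd n)).Realize e (Fin.append xs ys) :=
  realize_closeEx k _

theorem forall_fin_one {α : Type*} {P : (Fin 1 → α) → Prop} : (∀ v, P v) ↔ ∀ a, P ![a] := by
  rw [Fin.forall_fin_succ_pi]; simp only [Fin.forall_fin_zero_pi]; rfl

theorem exists_fin_one {α : Type*} {P : (Fin 1 → α) → Prop} : (∃ v, P v) ↔ ∃ a, P ![a] := by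
  rw [Fin.exists_fin_succ_pi]; simp only [Fin.exists_fin_zero_pi]; rfl

theorem forall_fin_two {α : Type*} {P : (Fin 2 → α) → Prop} :
    (∀ v, P v) ↔ ∀ a b, P ![a, b] := by
  rw [Fin.forall_fin_succ_pi]; simp only [forall_fin_one]; rfl

theorem exists_fin_two {α : Type*} {P : (Fin 2 → α) → Prop} :
    (∃ v, P v) ↔ ∃ a b, P ![a, b] := by
  rw [Fin.exists_fin_succ_pi]; simp only [exists_fin_one]; rfl

theorem forall_fin_three {α : Type*} {P : (Fin 3 → α) → Prop} :
    (∀ v, P v) ↔ ∀ a b c, P ![a, b, c] := by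
  rw [Fin.forall_fin_succ_pi]; simp only [forall_fin_two]; rfl

@[simp] theorem realize_subset (x y : Fin n) :
    (subset x y).Realize e xs ↔ Subset (xs x) (xs y) := by
  simp [subset, Subset, forall_fin_one]

@[simp] theorem realize_isEmpty (x : Fin n) : (isEmpty x).Realize e xs ↔ IsEmpty (xs x) := by
  simp [isEmpty, IsEmpty, forall_fin_one]

@[simp] theorem realize_isUnorderedPair (z a b : Fin n) :
    (isUnorderedPair z a b).Realize e xs ↔ IsUnorderedPair (xs z) (xs a) (xs b) := by
  simp [isUnorderedPair, IsUnorderedPair, forall_fin_one]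

@[simp] theorem realize_isPair (p a b : Fin n) :
    (isPair p a b).Realize e xs ↔ IsPair (xs p) (xs a) (xs b) := by
  simp [isPair, IsPair, forall_fin_one]

@[simp] theorem realize_isSucc (y x : Fin n) :
    (isSucc y x).Realize e xs ↔ IsInsert (xs y) (xs x) (xs x) := by
  simp [isSucc, IsInsert, forall_fin_one]

@[simp] theorem realize_isInductive (W : Fin n) :
    (isInductive W).Realize e xs ↔ IsInductive (xs W) := by
  simp [isInductive, IsInductive, forall_fin_one, exists_fin_one]

@[simp] theorem realize_isNat (m : Fin n) : (isNat m).Realize e xs ↔ IsNat (xs m) := by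
  simp [isNat, IsNat, forall_fin_one]

@[simp] theorem realize_pairMem (f a b : Fin n) :
    (pairMem f a b).Realize e xs ↔ PairMem (xs f) (xs a) (xs b) := by
  simp [pairMem, PairMem, exists_fin_one]

@[simp] theorem realize_isBijection (f A B : Fin n) :
    (isBijection f A B).Realize e xs ↔ IsBijection (xs f) (xs A) (xs B) := by
  simp [isBijection, IsBijection, forall_fin_one, exists_fin_one, exists_fin_two]

@[simp] theorem realize_opEq (f a b c : Fin n) :
    (opEq f a b c).Realize e xs ↔ OpEq (xs f) (xs a) (xs b) (xs c) := by
  simp [opEq, OpEq, exists_fin_one]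

@[simp] theorem realize_isIdeal (X : RingVars n) (I : Fin n) :
    (isIdeal X I).Realize e xs ↔
      IsIdeal (xs X.carrier) (xs X.add) (xs X.mul) (xs X.zero) (xs I) := by
  simp [isIdeal, IsIdeal, forall_fin_three]

@[simp] theorem realize_isPrimeIdeal (X : RingVars n) (P : Fin n) :
    (isPrimeIdeal X P).Realize e xs ↔
      IsPrimeIdeal (xs X.carrier) (xs X.add) (xs X.mul) (xs X.zero) (xs X.one) (xs P) := by
  simp [isPrimeIdeal, IsPrimeIdeal, forall_fin_three]

@[simp] theorem realize_isGeneratedBy (X : RingVars n) (I S : Fin n) :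
    (isGeneratedBy X I S).Realize e xs ↔
      IsGeneratedBy (xs X.carrier) (xs X.add) (xs X.mul) (xs X.zero) (xs I) (xs S) := by
  simp [isGeneratedBy, IsGeneratedBy, forall_fin_one, RingVars.map]

/-- The formula saying that `S` is a subset of `R` in bijection with `m`. -/
def isSubsetOfSize (R m S : Fin n) : Fml n :=
  subset S R ⊓ ex 1 fun w f => isBijection (f 0) (w m) (w S)

@[simp] theorem realize_isSubsetOfSize (R m S : Fin n) :
    (isSubsetOfSize R m S).Realize e xs ↔ IsSubsetOfSize (xs R) (xs m) (xs S) := by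
  simp [isSubsetOfSize, IsSubsetOfSize, exists_fin_one]

theorem realize_place {k m : ℕ} (φ : lang.Formula (Fin n ⊕ Fin k)) (ps : Fin n → Fin m)
    (ys : Fin k → Fin m) {xs : Fin m → M} :
    (place φ ps ys).Realize e xs ↔ φ.Realize (Sum.elim (xs ∘ ps) (xs ∘ ys)) := by
  rw [place, BoundedFormula.realize_relabel, Formula.Realize,
    Subsingleton.elim (xs ∘ Fin.natAdd m : Fin 0 → M) default]
  refine iff_of_eq (congrArg (fun g => BoundedFormula.Realize φ g default) (funext ?_))
  rintro (i | i) <;> rfl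

@[simp] theorem realize_place_one {m : ℕ} (φ : lang.Formula (Fin n ⊕ Fin 1)) (ps : Fin n → Fin m)
    (a : Fin m) {xs : Fin m → M} :
    (place φ ps ![a]).Realize e xs ↔ φ.Realize (Sum.elim (fun i => xs (ps i)) ![xs a]) := by
  rw [realize_place]
  refine iff_of_eq (congrArg φ.Realize (congrArg (Sum.elim _) (funext fun i => ?_)))
  fin_cases i; rfl

@[simp] theorem realize_place_two {m : ℕ} (φ : lang.Formula (Fin n ⊕ Fin 2)) (ps : Fin n → Fin m)
    (a b : Fin m) {xs : Fin m → M} :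
    (place φ ps ![a, b]).Realize e xs ↔
      φ.Realize (Sum.elim (fun i => xs (ps i)) ![xs a, xs b]) := by
  rw [realize_place]
  refine iff_of_eq (congrArg φ.Realize (congrArg (Sum.elim _) (funext fun i => ?_)))
  fin_cases i <;> rfl

/-- The formula `φ`, with its variables distributed over parameters and further variables. -/
def distribute {m k : ℕ} (φ : Fml m) (g : Fin m → Fin n ⊕ Fin k) :
    lang.Formula (Fin n ⊕ Fin k) :=
  φ.toFormula.relabel (Sum.elim Empty.elim g)

theorem realize_distribute {m k : ℕ} (φ : Fml m) (g : Fin m → Fin n ⊕ Fin k)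
    (u : Fin n ⊕ Fin k → M) : (distribute φ g).Realize u ↔ φ.Realize default (u ∘ g) := by
  rw [distribute, Formula.realize_relabel, BoundedFormula.realize_toFormula]
  refine iff_of_eq (congrArg (fun v => BoundedFormula.Realize φ v (u ∘ g)) ?_)
  exact Subsingleton.elim _ _

end Realize

/-! ### Consequences of the axioms in a model -/

section Axioms

variable [hM : M ⊨ ZFG0]

theorem realize_axiom {φ : lang.Sentence} (h : ZFG0 φ) :
    BoundedFormula.Realize φ (default : Empty → M) default :=
  hM.realize_of_mem φ h

theorem ext_of_mem {x y : M} (h : ∀ z, z ε x ↔ z ε y) : x = y := by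
  have := realize_axiom (M := M) ZFG0.extensionality
  simp [extensionality, forall_fin_one, forall_fin_two] at this
  exact this x y h

theorem exists_mem_disjoint {x y : M} (h : y ε x) : ∃ y, y ε x ∧ ∀ z, z ε y → ¬ z ε x := by
  have := realize_axiom (M := M) ZFG0.foundation
  simp [foundation, forall_fin_one, exists_fin_one] at this
  exact this x y h

theorem exists_isUnorderedPair (a b : M) : ∃ z, IsUnorderedPair z a b := by
  have := realize_axiom (M := M) ZFG0.pairing
  simp [pairing, forall_fin_two, exists_fin_one] at this
  exact this a b

theorem exists_union (x : M) : ∃ u, ∀ z, z ε u ↔ ∃ y, y ε x ∧ z ε y := by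
  have := realize_axiom (M := M) ZFG0.union
  simp [union, forall_fin_one, exists_fin_one] at this
  exact this x

variable (M) in
theorem exists_isInductive : ∃ W : M, IsInductive W := by
  have := realize_axiom (M := M) ZFG0.infinity
  simp [infinity, exists_fin_one] at this
  exact this

/-- Separation for a formula whose variable `0` runs over the given set and whose other variables
are parameters. -/
theorem exists_separation {n : ℕ} (φ : Fml (n + 1)) (p : Fin n → M) (A : M) {P : M → Prop}
    (hP : ∀ x, φ.Realize default (vecCons x p) ↔ P x) : ∃ B, ∀ x, x ε B ↔ x ε A ∧ P x := by
  have := realize_axiom (M := M)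
    (ZFG0.separation (distribute φ (Fin.cases (Sum.inr 0) Sum.inl)))
  rw [separation] at this
  have := BoundedFormula.realize_alls.1 this p
  simp [forall_fin_one, exists_fin_one, realize_distribute] at this
  obtain ⟨B, hB⟩ := this A
  refine ⟨B, fun x => (hB x).trans (and_congr_right fun _ => (iff_of_eq ?_).trans (hP x))⟩
  exact congrArg _ (funext fun i => by cases i using Fin.cases <;> rfl)

/-- Replacement for a formula whose variable `0` runs over the given set, whose variable `1` is the
value, and whose other variables are parameters. -/
theorem exists_replacement {n : ℕ} (φ : Fml (n + 2)) (p : Fin n → M) (A : M) {P : M → M → Prop}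
    (hP : ∀ x y, φ.Realize default (vecCons x (vecCons y p)) ↔ P x y)
    (hA : ∀ x y z, x ε A → P x y → P x z → y = z) :
    ∃ B, ∀ y, y ε B ↔ ∃ x, x ε A ∧ P x y := by
  have := realize_axiom (M := M) (ZFG0.replacement
    (distribute φ (Fin.cases (Sum.inr 0) (Fin.cases (Sum.inr 1) Sum.inl))))
  rw [replacement] at this
  have := BoundedFormula.realize_alls.1 this p
  have hg : ∀ x y, (Sum.elim p ![x, y] ∘
      (Fin.cases (Sum.inr 0) (Fin.cases (Sum.inr 1) Sum.inl) : Fin (n + 2) → Fin n ⊕ Fin 2)) =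
      vecCons x (vecCons y p) := fun x y => funext fun i => by
    cases i using Fin.cases with
    | zero => rfl
    | succ i => cases i using Fin.cases <;> rfl
  simp [forall_fin_one, forall_fin_three, exists_fin_one, realize_distribute, hg, hP] at this
  exact this A fun x y z hx hy hz => hA x y z hx hy hz

/-- The union of a family of sets indexed by the members of a set; the variables `0` and `1` of the
formula are the index and the set. -/
theorem exists_iUnion {n : ℕ} (φ : Fml (n + 2)) (p : Fin n → M) (A : M) {P : M → M → Prop}
    (hP : ∀ x B, φ.Realize default (vecCons x (vecCons B p)) ↔ ∀ y, y ε B ↔ P x y)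
    (hA : ∀ x, x ε A → ∃ B, ∀ y, y ε B ↔ P x y) :
    ∃ U, ∀ y, y ε U ↔ ∃ x, x ε A ∧ P x y := by
  -- By extensionality the set of all `y` with `P x y` is determined by `x`, so replacement collects
  -- these sets.
  obtain ⟨C, hC⟩ := exists_replacement φ p A hP fun x y z _ hy hz =>
    ext_of_mem fun t => (hy t).trans (hz t).symm
  obtain ⟨U, hU⟩ := exists_union C
  refine ⟨U, fun y => (hU y).trans ⟨?_, ?_⟩⟩
  · rintro ⟨B, hB, hy⟩
    obtain ⟨x, hx, h⟩ := (hC B).1 hB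
    exact ⟨x, hx, (h y).1 hy⟩
  · rintro ⟨x, hx, hy⟩
    obtain ⟨B, hB⟩ := hA x hx
    exact ⟨B, (hC B).2 ⟨x, hx, hB⟩, (hB y).2 hy⟩

/-- Foundation for `{x}`. -/
theorem not_mem_self (x : M) : ¬ x ε x := fun h => by
  obtain ⟨s, hs⟩ := exists_isUnorderedPair x x
  obtain ⟨y, hy, hd⟩ := exists_mem_disjoint ((hs x).2 (Or.inl rfl))
  obtain rfl : y = x := by simpa using (hs y).1 hy
  exact hd y h hy

/-- The singleton `{c}` is a member of `p`, hence equals `{a}` or `{a, b}`, and contains `a` either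
way. -/
theorem IsPair.fst_eq {p a b c d : M} (h : IsPair p a b) (h' : IsPair p c d) : a = c := by
  obtain ⟨s, hs⟩ := exists_isUnorderedPair c c
  have hc : c ε s := (hs c).2 (Or.inl rfl)
  have ha : a ε s := by
    rcases (h s).1 ((h' s).2 (Or.inl hs)) with h | h <;> exact (h a).2 (Or.inl rfl)
  simpa using (hs a).1 ha

theorem IsInsert.unique {x y s r : M} (hx : IsInsert x s r) (hy : IsInsert y s r) : x = y :=
  ext_of_mem fun z => (hx z).trans (hy z).symm

theorem IsEmpty.unique {x y : M} (hx : IsEmpty x) (hy : IsEmpty y) : x = y :=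
  ext_of_mem fun z => iff_of_false (hx z) (hy z)

/-! ### Natural numbers and induction -/

variable (M) in
theorem exists_omega : ∃ ω : M, ∀ m, m ε ω ↔ IsNat m := by
  obtain ⟨W, hW⟩ := exists_isInductive M
  obtain ⟨ω, hω⟩ := exists_separation (isNat 0) ![] W (P := IsNat) fun x => by simp
  exact ⟨ω, fun m => (hω m).trans (and_iff_right_of_imp fun h => h W hW)⟩

theorem IsNat.of_isEmpty {m : M} (hm : IsEmpty m) : IsNat m := fun W hW => by
  obtain ⟨x, hx, hxW⟩ := hW.1
  exact hm.unique hx ▸ hxW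

theorem IsNat.succ {m k : M} (hm : IsNat m) (hk : IsInsert k m m) : IsNat k := fun W hW => by
  obtain ⟨y, hy, hyW⟩ := hW.2 m (hm W hW)
  exact hk.unique hy ▸ hyW

/-- Induction on the natural numbers, for a class that is defined by a formula with parameters. -/
theorem IsNat.induction {n : ℕ} (φ : Fml (n + 1)) (p : Fin n → M) {P : M → Prop}
    (hP : ∀ x, φ.Realize default (vecCons x p) ↔ P x) (zero : ∀ m, IsEmpty m → P m)
    (succ : ∀ m k, IsInsert k m m → P m → P k) {m : M} (hm : IsNat m) : P m := by
  obtain ⟨W, hW⟩ := exists_isInductive M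
  obtain ⟨ω, hω⟩ := exists_omega M
  obtain ⟨B, hB⟩ := exists_separation φ p ω hP
  -- The natural numbers satisfying `P` form an inductive set `B`; the inductive set `W` only
  -- supplies the empty set and the successors.
  refine ((hB m).1 (hm B ⟨?_, fun x hx => ?_⟩)).2
  · obtain ⟨x, hx, -⟩ := hW.1
    exact ⟨x, hx, (hB x).2 ⟨(hω x).2 (.of_isEmpty hx), zero x hx⟩⟩
  · obtain ⟨hxω, hPx⟩ := (hB x).1 hx
    have hx := (hω x).1 hxω
    obtain ⟨y, hy, -⟩ := hW.2 x (hx W hW)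
    exact ⟨y, hy, (hB y).2 ⟨(hω y).2 (hx.succ hy), succ x y hy hPx⟩⟩

/-! ### The set of finite subsets -/

/-- A set of size `m + 1` arises from a set of size `m` by inserting one element. -/
theorem IsSubsetOfSize.exists_isInsert {R m k S : M} (hk : IsInsert k m m)
    (hS : IsSubsetOfSize R k S) :
    ∃ s, IsSubsetOfSize R m s ∧ ∃ r, r ε R ∧ IsInsert S s r := by
  obtain ⟨hSR, f, ⟨hf, hdom⟩, hran⟩ := hS
  obtain ⟨r, hr, hmr⟩ := hdom m ((hk m).2 (Or.inr rfl))
  obtain ⟨a, -, har⟩ := hran r hr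
  obtain rfl : m = a := (har m).1 ((hmr r).2 rfl)
  -- With `k = m ∪ {m}` and `r = f(m)`, removing `r` from `S` and the pair `(m, r)` from `f` leaves
  -- a bijection `g` from `m` to `s`.
  obtain ⟨s, hs⟩ := exists_separation (∼(eq 0 1)) ![r] S (P := fun x => ¬ x = r) fun x => by simp
  obtain ⟨g, hg⟩ := exists_separation (∼(isPair 0 1 2)) ![m, r] f (P := fun q => ¬ IsPair q m r)
    fun x => by simp
  have hpair : ∀ {a b}, a ≠ m → (PairMem g a b ↔ PairMem f a b) := fun ha =>
    exists_congr fun q => and_congr_right fun hq =>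
      (hg q).trans (and_iff_left fun h => ha (hq.fst_eq h))
  have hm : ∀ {b}, ¬ PairMem g m b := fun {b} => by
    rintro ⟨q, hq, hqg⟩
    obtain ⟨hqf, hne⟩ := (hg q).1 hqg
    obtain rfl := (hmr b).1 ⟨q, hq, hqf⟩
    exact hne hq
  refine ⟨s, ⟨fun x hx => hSR x ((hs x).1 hx).1, g, ⟨fun q hq => ?_, fun a ha => ?_⟩,
    fun b hb => ?_⟩, r, hSR r hr, fun x => ?_⟩
  · obtain ⟨hqf, hne⟩ := (hg q).1 hq
    obtain ⟨a, b, ⟨ha, hb⟩, hab⟩ := hf q hqf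
    have ham : a ≠ m := by
      rintro rfl
      exact hm ⟨q, hab, hq⟩
    refine ⟨a, b, ⟨((hk a).1 ha).resolve_right ham, (hs b).2 ⟨hb, ?_⟩⟩, hab⟩
    rintro rfl
    exact ham ((har a).1 ⟨q, hab, hqf⟩)
  · have ham : a ≠ m := by
      rintro rfl
      exact not_mem_self a ha
    obtain ⟨b, hb, hab⟩ := hdom a ((hk a).2 (Or.inl ha))
    refine ⟨b, (hs b).2 ⟨hb, ?_⟩, fun c => (hpair ham).trans (hab c)⟩
    rintro rfl
    exact ham ((har a).1 ((hab b).2 rfl))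
  · obtain ⟨hbS, hbr⟩ := (hs b).1 hb
    obtain ⟨a, ha, hab⟩ := hran b hbS
    have ham : a ≠ m := by
      rintro rfl
      exact hbr ((hmr b).1 ((hab a).2 rfl))
    refine ⟨a, ((hk a).1 ha).resolve_right ham, fun c => ?_⟩
    by_cases hc : c = m
    · subst hc
      exact iff_of_false hm ham.symm
    · exact (hpair hc).trans (hab c)
  · rw [hs x]
    by_cases hx : x = r
    · simp [hx, hr]
    · simp [hx]

/-- For fixed `s`, replacement over `r` in `R` collects the sets `s ∪ {r}`; a union over `s` in `F`
follows. Replacement asks only for uniqueness of `s ∪ {r}`. -/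
theorem exists_insertions (F R : M) : ∃ G, ∀ S, S ε G ↔ ∃ s, s ε F ∧ ∃ r, r ε R ∧ IsInsert S s r :=
  exists_iUnion
    (all 1 fun w S => S 0 ∈ᶠ w 1 ⇔ ex 1 fun w' r => r 0 ∈ᶠ w' (w 2) ⊓
      all 1 fun w'' x => x 0 ∈ᶠ w'' (w' (S 0)) ⇔ (x 0 ∈ᶠ w'' (w' (w 0)) ⊔ x 0 ≐ᶠ w'' (r 0)))
    ![R] F (fun s B => by simp [forall_fin_one, exists_fin_one, IsInsert]; rfl) fun s _ =>
      exists_replacement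
        (all 1 fun w x => x 0 ∈ᶠ w 1 ⇔ (x 0 ∈ᶠ w 2 ⊔ x 0 ≐ᶠ w 0)) ![s] R
        (P := fun r S => IsInsert S s r) (fun r S => by simp [forall_fin_one, IsInsert]; rfl)
        fun _ _ _ _ h h' => h.unique h'

/-- The subsets of `R` that are in bijection with the natural number `m` form a set. -/
theorem exists_subsetsOfSize (R : M) {m : M} (hm : IsNat m) :
    ∃ F, ∀ S, S ε F ↔ IsSubsetOfSize R m S := by
  -- A set containing all these subsets suffices, by separation. This weaker claim suits the
  -- induction, since inserting an `r` already in `s` gives a set of the wrong size.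
  suffices h : ∃ F, ∀ S, IsSubsetOfSize R m S → S ε F by
    obtain ⟨F, hF⟩ := h
    obtain ⟨G, hG⟩ := exists_separation (isSubsetOfSize 1 2 0) ![R, m] F
      (P := IsSubsetOfSize R m) fun x => by simp
    exact ⟨G, fun S => (hG S).trans (and_iff_right_of_imp (hF S))⟩
  refine hm.induction (P := fun m => ∃ F, ∀ S, IsSubsetOfSize R m S → S ε F)
    (ex 1 fun w F => all 1 fun w' S =>
      isSubsetOfSize (w' (w 1)) (w' (w 0)) (S 0) ⟹ S 0 ∈ᶠ w' (F 0))
    ![R] (fun m => by simp [forall_fin_one, exists_fin_one]; rfl) (fun m hm => ?_) fun m k hk => ?_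
  -- A set in bijection with the empty set `m` is empty, hence equal to `m`, so `{m}` serves.
  · obtain ⟨F, hF⟩ := exists_isUnorderedPair m m
    refine ⟨F, fun S hS => (hF S).2 (Or.inl (IsEmpty.unique (fun x hx => ?_) hm))⟩
    obtain ⟨-, f, -, hran⟩ := hS
    obtain ⟨a, ha, -⟩ := hran x hx
    exact hm a ha
  · rintro ⟨F, hF⟩
    obtain ⟨G, hG⟩ := exists_insertions F R
    refine ⟨G, fun S hS => (hG S).2 ?_⟩
    obtain ⟨s, hs, h⟩ := hS.exists_isInsert hk
    exact ⟨s, hF s hs, h⟩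

/-- The finite subsets of a set form a set. -/
theorem exists_finiteSubsets (R : M) :
    ∃ F, ∀ S, S ε F ↔ ∃ m, IsNat m ∧ IsSubsetOfSize R m S := by
  obtain ⟨ω, hω⟩ := exists_omega M
  obtain ⟨F, hF⟩ := exists_iUnion (P := IsSubsetOfSize R)
    (all 1 fun w S => S 0 ∈ᶠ w 1 ⇔ isSubsetOfSize (w 2) (w 0) (S 0)) ![R] ω
    (fun m B => by simp [forall_fin_one]; rfl) fun m hm => exists_subsetsOfSize R ((hω m).1 hm)
  exact ⟨F, fun S => (hF S).trans (by simp only [hω])⟩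

/-! ### The sets of ideals and of prime ideals -/

theorem IsGeneratedBy.unique {R add mul zero I J S : M} (hI : IsGeneratedBy R add mul zero I S)
    (hJ : IsGeneratedBy R add mul zero J S) : I = J :=
  ext_of_mem fun x => ⟨hI.2 J hJ.1 x, hJ.2 I hI.1 x⟩

/-- If every ideal is generated by a finite subset, then the ideals form a set. -/
theorem exists_setOfIdeals {R add mul zero : M}
    (h : ∀ I, IsIdeal R add mul zero I →
      ∃ S, (∃ m, IsNat m ∧ IsSubsetOfSize R m S) ∧ IsGeneratedBy R add mul zero I S) :
    ∃ Id, ∀ I, I ε Id ↔ IsIdeal R add mul zero I := by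
  obtain ⟨F, hF⟩ := exists_finiteSubsets R
  -- The final `2` is a filler: being a generated ideal does not involve the unit.
  obtain ⟨Id, hId⟩ := exists_replacement (isGeneratedBy ⟨2, 3, 4, 5, 2⟩ 1 0)
    ![R, add, mul, zero] F (P := fun S I => IsGeneratedBy R add mul zero I S)
    (fun S I => by simp) fun _ _ _ _ hI hJ => hI.unique hJ
  refine ⟨Id, fun I => (hId I).trans ⟨fun ⟨S, _, hS⟩ => hS.1.1, fun hI => ?_⟩⟩
  obtain ⟨S, hS, hg⟩ := h I hI
  exact ⟨S, (hF S).2 hS, hg⟩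

theorem exists_setOfPrimeIdeals {R add mul zero Id : M} (one : M)
    (hId : ∀ I, I ε Id ↔ IsIdeal R add mul zero I) :
    ∃ Spec, ∀ P, P ε Spec ↔ IsPrimeIdeal R add mul zero one P := by
  obtain ⟨Spec, h⟩ := exists_separation (isPrimeIdeal ⟨1, 2, 3, 4, 5⟩ 0)
    ![R, add, mul, zero, one] Id (P := IsPrimeIdeal R add mul zero one) fun P => by simp
  exact ⟨Spec, fun P => (h P).trans (and_iff_right_of_imp fun hP => (hId P).2 hP.1.1)⟩

end Axioms

end Semantics

end ZFG

open ZFG in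
theorem theoremT : ZFG.ZFG0 ⊨ᵇ ZFG.noetherianRingsHaveIdAndSpec := by
  intro M e xs
  simp only [noetherianRingsHaveIdAndSpec, realize_all]
  intro X
  simp [isNoetherianRing, hasSetOfIdeals, hasSetOfPrimeIdeals, isFinite, forall_fin_one,
    exists_fin_one, exists_fin_two, RingVars.map]
  intro _ h
  obtain ⟨Id, hId⟩ := exists_setOfIdeals fun I hI => by
    obtain ⟨S, ⟨hSR, m, f, hm, hf⟩, hS⟩ := h I hI
    exact ⟨S, ⟨m, hm, hSR, f, hf⟩, hS⟩
  exact ⟨⟨Id, hId⟩, exists_setOfPrimeIdeals _ hId⟩
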